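/- Let $\Theta$ be a nonempty compact metric space (the parameter space), $U$ a compact metric space (the decision space), both with their Borel $\sigma$-algebras, and let $\mathcal H$ be a complex Hilbert space. Let $\rho$ assign to each $\theta\in\Theta$ a density operator $\rho(\theta)$ on $\mathcal H$, that is, a positive trace-class operator with $\operatorname{Tr}\rho(\theta)=1$. Suppose that $\rho$ is regular: for every compact $K\subseteq\Theta$, $\lim_{\delta\to 0^+}\omega_\rho(K_\delta)=0$, where $$\omega_\rho(K_\delta)=\inf\bigl\{\|X\|_1 : X \text{ trace class},\ -X\le \rho(\theta)-\rho(\eta)\le X \text{ for all } \theta,\eta\in K \text{ with } d(\theta,\eta)<\delta\bigr\}$$ (with $\inf\emptyset=+\infty$). Let $\mathrm{Po}(U)$ be the set of all positive-operator-valued measures $M$ on $U$: $M(B)\ge 0$ is a bounded operator on $\mathcal H$ for every Borel set $B$, $M$ is countably additive in the weak operator topology, and $M(U)=I$. Let $w:\Theta\times U\to\mathbb R$ be a bounded continuous loss function, and for $M\in\mathrm{Po}(U)$ let $$R_M(\theta)=\int_U w(\theta,u)\,\operatorname{Tr}\bigl(\rho(\theta)M(du)\bigr)$$ be its risk function, where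 $\operatorname{Tr}(\rho(\theta)M(\cdot))$ is the probability measure $B\mapsto\operatorname{Tr}(\rho(\theta)M(B))$. Let $\mathcal P(\Theta)$ be the set of Borel probability measures on $\Theta$. Then for all $M\in\mathrm{Po}(U)$, $\theta\in\Theta$ and $\pi\in\mathcal P(\Theta)$ the function $w(\theta,\cdot)$ is integrable with respect to $\operatorname{Tr}(\rho(\theta)M(\cdot))$ and $R_M$ is integrable with respect to $\pi$, and $$\inf_{M\in\mathrm{Po}(U)}\ \sup_{\theta\in\Theta} R_M(\theta)=\sup_{\pi\in\mathcal P(\Theta)}\ \inf_{M\in\mathrm{Po}(U)}\int_\Theta R_M(\theta)\,\pi(d\theta).$$ -/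

import Mathlib

open MeasureTheory Filter
open scoped Topology ENNReal InnerProductSpace

namespace QuantumDecision

noncomputable section

/-! ### Trace-class operators on a complex Hilbert space -/

section TraceClass

variable (H : Type*) [NormedAddCommGroup H] [InnerProductSpace ℂ H] [CompleteSpace H]

/-- Index set of a fixed orthonormal (Hilbert) basis of `H`. -/
def BasisIndex : Set H := (exists_hilbertBasis ℂ H).choose

/-- A fixed orthonormal (Hilbert) basis of `H`. The trace norm and the trace of a trace-class
operator, defined below, do not depend on this choice. -/
def basis : HilbertBasis (BasisIndex H) ℂ H := (exists_hilbertBasis ℂ H).choose_spec.choose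

variable {H}

/-- The trace norm `‖T‖₁ = Tr |T|`, where `|T| = (T† T)^{1/2}`, with value `∞` if the sum of the
nonnegative numbers `⟪eᵢ, |T| eᵢ⟫` diverges. -/
def traceNorm (T : H →L[ℂ] H) : ℝ≥0∞ :=
  ∑' i, ENNReal.ofReal (RCLike.re ⟪basis H i, CFC.abs T (basis H i)⟫_ℂ)

/-- An operator is trace class if its trace norm is finite. -/
def IsTraceClass (T : H →L[ℂ] H) : Prop := traceNorm T < ∞

/-- The trace `Tr T = ∑ᵢ ⟪eᵢ, T eᵢ⟫` (meaningful for trace-class operators). -/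
def trace (T : H →L[ℂ] H) : ℂ := ∑' i, ⟪basis H i, T (basis H i)⟫_ℂ

variable (H) in
/-- Density operators: positive trace-class operators of trace one. -/
structure DensityOperator where
  /-- The underlying bounded operator. -/
  toCLM : H →L[ℂ] H
  nonneg : 0 ≤ toCLM
  isTraceClass : IsTraceClass toCLM
  trace_eq_one : trace toCLM = 1

/-! Facts needed to see that the Born rule defines a measure. -/

theorem inner_sqrt_left (T : H →L[ℂ] H) (x y : H) :
    ⟪CFC.sqrt T x, y⟫_ℂ = ⟪x, CFC.sqrt T y⟫_ℂ :=
  ((ContinuousLinearMap.nonneg_iff_isPositive _).1 (CFC.sqrt_nonneg T)).isSymmetric x y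

theorem inner_apply_of_nonneg {T : H →L[ℂ] H} (hT : 0 ≤ T) (x y : H) :
    ⟪x, T y⟫_ℂ = ⟪CFC.sqrt T x, CFC.sqrt T y⟫_ℂ := by
  rw [inner_sqrt_left]
  conv_lhs => rw [← CFC.sqrt_mul_sqrt_self T hT]
  rfl

theorem summable_sqrt {T : H →L[ℂ] H} (hT : 0 ≤ T) (hT' : IsTraceClass T) :
    Summable fun i => ‖CFC.sqrt T (basis H i)‖ ^ 2 := by
  have h : traceNorm T = ∑' i, ENNReal.ofReal (‖CFC.sqrt T (basis H i)‖ ^ 2) := by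
    unfold traceNorm
    congr 1
    funext i
    rw [CFC.abs_of_nonneg T hT, inner_apply_of_nonneg hT, inner_self_eq_norm_sq]
  have h2 := ENNReal.summable_toReal (f := fun i => ENNReal.ofReal (‖CFC.sqrt T (basis H i)‖ ^ 2))
    (by rw [← h]; exact hT'.ne)
  refine h2.congr fun i => ?_
  rw [ENNReal.toReal_ofReal (by positivity)]

theorem hasSum_norm_inner_sq (x : H) :
    HasSum (fun j => ‖⟪basis H j, x⟫_ℂ‖ ^ 2) (‖x‖ ^ 2) := by
  have h := (basis H).hasSum_inner_mul_inner x x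
  have h2 := (RCLike.hasSum_re ℂ h)
  rw [inner_self_eq_norm_sq] at h2
  refine h2.congr_fun fun j => ?_
  rw [← inner_conj_symm x, RCLike.conj_mul]
  norm_cast

theorem summable_norm_inner_sq {B : H →L[ℂ] H}
    (hB : Summable fun i => ‖B (basis H i)‖ ^ 2) :
    Summable fun p : BasisIndex H × BasisIndex H =>
      ‖⟪basis H p.2, B (basis H p.1)⟫_ℂ‖ ^ 2 := by
  refine (summable_prod_of_nonneg fun p => sq_nonneg _).2
    ⟨fun i => (hasSum_norm_inner_sq (B (basis H i))).summable, hB.congr fun i => ?_⟩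
  exact (hasSum_norm_inner_sq (B (basis H i))).tsum_eq.symm

/-- `Tr (T A) = ∑ⱼ ⟪T^{1/2} eⱼ, A T^{1/2} eⱼ⟫` for positive trace-class `T` and bounded `A`. -/
theorem trace_mul_eq {T : H →L[ℂ] H} (hT : 0 ≤ T) (hT' : IsTraceClass T) (A : H →L[ℂ] H) :
    trace (T * A) =
      ∑' j, ⟪CFC.sqrt T (basis H j), A (CFC.sqrt T (basis H j))⟫_ℂ := by
  set S := CFC.sqrt T with hS
  set e := basis H with he
  let F : BasisIndex H → BasisIndex H → ℂ := fun i j => ⟪S (e i), e j⟫_ℂ * ⟪e j, S (A (e i))⟫_ℂ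
  have hF : ∀ i j, F i j = ⟪S (e i), e j⟫_ℂ * ⟪(ContinuousLinearMap.adjoint A * S) (e j), e i⟫_ℂ := by
    intro i j
    simp only [F]
    rw [← inner_sqrt_left]
    exact congrArg _ (ContinuousLinearMap.adjoint_inner_left A (e i) (S (e j))).symm
  have hS2 := summable_sqrt hT hT'
  have hAS : Summable fun i => ‖(ContinuousLinearMap.adjoint A * S) (e i)‖ ^ 2 := by
    refine Summable.of_nonneg_of_le (fun i => by positivity) (fun i => ?_)
      (hS2.mul_left (‖ContinuousLinearMap.adjoint A‖ ^ 2))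
    rw [← mul_pow]
    exact pow_le_pow_left₀ (norm_nonneg _) ((ContinuousLinearMap.adjoint A).le_opNorm _) 2
  have hsum : Summable (Function.uncurry F) := by
    have h1 := summable_norm_inner_sq hS2
    have h2 := (summable_norm_inner_sq hAS).prod_symm
    refine Summable.of_norm_bounded (h1.add h2) fun p => ?_
    change ‖F p.1 p.2‖ ≤ _
    rw [hF, norm_mul]
    have e1 : ‖⟪S (e p.1), e p.2⟫_ℂ‖ = ‖⟪e p.2, S (e p.1)⟫_ℂ‖ := norm_inner_symm _ _
    have e2 := norm_inner_symm (𝕜 := ℂ) ((ContinuousLinearMap.adjoint A * S) (e p.2)) (e p.1)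
    rw [e1, e2]
    simp only [Prod.swap]
    nlinarith [sq_nonneg (‖⟪e p.2, S (e p.1)⟫_ℂ‖ -
      ‖⟪e p.1, (ContinuousLinearMap.adjoint A * S) (e p.2)⟫_ℂ‖),
      sq_nonneg (‖⟪e p.2, S (e p.1)⟫_ℂ‖),
      sq_nonneg ‖⟪e p.1, (ContinuousLinearMap.adjoint A * S) (e p.2)⟫_ℂ‖]
  have hL : ∀ i, ⟪e i, (T * A) (e i)⟫_ℂ = ∑' j, F i j := by
    intro i
    change ⟪e i, T (A (e i))⟫_ℂ = _
    rw [inner_apply_of_nonneg hT]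
    exact (e.hasSum_inner_mul_inner _ _).tsum_eq.symm
  have hR : ∀ j, ⟪S (e j), A (S (e j))⟫_ℂ = ∑' i, F i j := by
    intro j
    rw [← ContinuousLinearMap.adjoint_inner_left]
    refine ((e.hasSum_inner_mul_inner _ _).tsum_eq.symm).trans (tsum_congr fun i => ?_)
    rw [hF, inner_sqrt_left, mul_comm]
    rfl
  unfold trace
  rw [tsum_congr hL, tsum_congr hR, hsum.tsum_comm]

theorem ofReal_re_trace_mul {T A : H →L[ℂ] H} (hT : 0 ≤ T) (hT' : IsTraceClass T) (hA : 0 ≤ A) :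
    ENNReal.ofReal (trace (T * A)).re =
      ∑' j, ENNReal.ofReal
        (⟪CFC.sqrt T (basis H j), A (CFC.sqrt T (basis H j))⟫_ℂ).re := by
  have hpos : ∀ x, 0 ≤ (⟪x, A x⟫_ℂ).re := fun x =>
    ((ContinuousLinearMap.nonneg_iff_isPositive A).1 hA).re_inner_nonneg_right x
  have hs : Summable fun j => ⟪CFC.sqrt T (basis H j), A (CFC.sqrt T (basis H j))⟫_ℂ := by
    refine Summable.of_norm_bounded ((summable_sqrt hT hT').mul_left ‖A‖) fun j => ?_
    refine (norm_inner_le_norm _ _).trans ?_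
    have := A.le_opNorm (CFC.sqrt T (basis H j))
    nlinarith [norm_nonneg (CFC.sqrt T (basis H j))]
  rw [trace_mul_eq hT hT', ← ENNReal.ofReal_tsum_of_nonneg (fun j => hpos _)
    (Complex.hasSum_re hs.hasSum).summable, Complex.re_tsum hs]

end TraceClass

/-! ### Regular operator-valued functions -/

section Regular

variable {Θ : Type*} [MetricSpace Θ]
  {H : Type*} [NormedAddCommGroup H] [InnerProductSpace ℂ H] [CompleteSpace H]

/-- The modulus `ω_T(K_δ)`: the infimum of `‖X‖₁` over the trace-class `X` such that
`-X ≤ T θ - T η ≤ X` for all `θ, η ∈ K` with `d(θ, η) < δ`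
(it is `∞` if there is no such `X`). -/
def modulus (T : Θ → H →L[ℂ] H) (K : Set Θ) (δ : ℝ) : ℝ≥0∞ :=
  sInf {r | ∃ X : H →L[ℂ] H, IsTraceClass X ∧
    (∀ θ ∈ K, ∀ η ∈ K, dist θ η < δ → -X ≤ T θ - T η ∧ T θ - T η ≤ X) ∧ r = traceNorm X}

/-- Regularity: `ω_T(K_δ) → 0` as `δ → 0⁺`, for every compact `K`. -/
def IsRegularFamily (T : Θ → H →L[ℂ] H) : Prop :=
  ∀ K : Set Θ, IsCompact K → Tendsto (modulus T K) (𝓝[>] 0) (𝓝 0)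

end Regular

/-! ### POVMs, the Born rule, and risk functions -/

section Decision

variable (U : Type*) [MeasurableSpace U]
  (H : Type*) [NormedAddCommGroup H] [InnerProductSpace ℂ H]

/-- A positive-operator-valued measure on `U`: a function from measurable sets to positive bounded
operators on `H`, countably additive in the weak operator topology, whose value on the whole space
is the identity. -/
structure POVM where
  /-- The underlying operator-valued measure, countably additive in the weak operator topology. -/
  toVectorMeasure : VectorMeasure U (H →WOT[ℂ] H)
  nonneg : ∀ B, MeasurableSet B → 0 ≤ (toVectorMeasure B).toCLM
  univ_eq_one : toVectorMeasure Set.univ = 1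

variable {U H}

/-- The operator `M(B)`. -/
def POVM.effect (M : POVM U H) (B : Set U) : H →L[ℂ] H := (M.toVectorMeasure B).toCLM

theorem POVM.effect_empty (M : POVM U H) : M.effect ∅ = 0 := by
  simp [POVM.effect]

theorem POVM.hasSum_re_inner (M : POVM U H) {B : ℕ → Set U} (hB : ∀ k, MeasurableSet (B k))
    (hd : Pairwise (Function.onFun Disjoint B)) (x : H) :
    HasSum (fun k => (⟪x, M.effect (B k) x⟫_ℂ).re) (⟪x, M.effect (⋃ k, B k) x⟫_ℂ).re := by
  have h := M.toVectorMeasure.m_iUnion hB hd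
  have hc : Continuous fun A : H →WOT[ℂ] H => innerSL ℂ x (A x) :=
    ContinuousLinearMapWOT.continuous_dual_apply x (innerSL ℂ x)
  have h2 := h.map (AddMonoidHom.mk' (fun A : H →WOT[ℂ] H => innerSL ℂ x (A x))
    (fun A B => by simp [inner_add_right])) hc
  exact Complex.hasSum_re h2

variable [CompleteSpace H]

/-- The Born rule: the distribution `B ↦ Tr (ρ M(B))` of the outcome of the measurement `M` in the
state `ρ`. -/
def born (ρ : DensityOperator H) (M : POVM U H) : Measure U :=
  Measure.ofMeasurable (fun B _ => ENNReal.ofReal (trace (ρ.toCLM * M.effect B)).re)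
    (by simp [POVM.effect_empty, trace])
    (by
      intro B hB hd
      have hpos : ∀ C : Set U, MeasurableSet C → ∀ x, 0 ≤ (⟪x, M.effect C x⟫_ℂ).re :=
        fun C hC x => ((ContinuousLinearMap.nonneg_iff_isPositive _).1
          (M.nonneg C hC)).re_inner_nonneg_right x
      rw [ofReal_re_trace_mul ρ.nonneg ρ.isTraceClass
        (show 0 ≤ M.effect _ from M.nonneg _ (MeasurableSet.iUnion hB))]
      rw [tsum_congr fun k => ofReal_re_trace_mul ρ.nonneg ρ.isTraceClass
        (show 0 ≤ M.effect _ from M.nonneg _ (hB k))]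
      rw [ENNReal.tsum_comm]
      refine tsum_congr fun j => ?_
      have h := M.hasSum_re_inner hB hd (CFC.sqrt ρ.toCLM (basis H j))
      rw [← ENNReal.ofReal_tsum_of_nonneg (fun k => hpos _ (hB k) _) h.summable]
      exact congrArg ENNReal.ofReal h.tsum_eq.symm)

theorem born_apply (ρ : DensityOperator H) (M : POVM U H) {B : Set U} (hB : MeasurableSet B) :
    born ρ M B = ENNReal.ofReal (trace (ρ.toCLM * M.effect B)).re :=
  Measure.ofMeasurable_apply B hB

/-- The risk function `R_M(θ) = ∫_U w(θ, u) Tr (ρ(θ) M(du))`. -/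
def risk {Θ : Type*} (ρ : Θ → DensityOperator H) (w : Θ × U → ℝ) (M : POVM U H) (θ : Θ) : ℝ :=
  ∫ u, w (θ, u) ∂(born (ρ θ) M)

end Decision

end

end QuantumDecision

/-! Hahn–Banach separation in `C(Θ, ℝ)` carries the proof; the space of measurements is given no
topology and the infimum need not be attained. Randomizing between POVMs makes the risk functions a
convex set (`convex_range_risk`), and regularity makes each of them continuous (`continuous_risk`):
an operator `X` dominating `ρ θ - ρ η` bounds the change of the outcome law by a measure of total
mass `‖X‖₁`, whatever the POVM. If the real number `c` is strictly below the minimax value, no risk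
function lies below `c` everywhere, so this convex set misses the open convex set of functions below
`c`. The separating functional is positive, hence a measure by Riesz, and after normalization it is
a prior for which every average risk is at least `c`
(`exists_probabilityMeasure_forall_le_integral`). The other inequality says that a mean is at most a
supremum. -/

namespace QuantumDecision

/-! ### Trace inequalities for positive operators -/

section Trace

variable {H : Type*} [NormedAddCommGroup H] [InnerProductSpace ℂ H] [CompleteSpace H]

theorem tsum_ofReal_norm_inner_sq (x : H) :
    ∑' j, ENNReal.ofReal (‖⟪basis H j, x⟫_ℂ‖ ^ 2) = ENNReal.ofReal (‖x‖ ^ 2) := by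
  have h := hasSum_norm_inner_sq x
  rw [← ENNReal.ofReal_tsum_of_nonneg (fun j => sq_nonneg _) h.summable, h.tsum_eq]

/-- The two sums are the squared Hilbert–Schmidt norms of an operator and its adjoint, infinite
values allowed. -/
theorem tsum_norm_sq_sqrt_comm (A T : H →L[ℂ] H) :
    ∑' j, ENNReal.ofReal (‖CFC.sqrt A (CFC.sqrt T (basis H j))‖ ^ 2) =
      ∑' j, ENNReal.ofReal (‖CFC.sqrt T (CFC.sqrt A (basis H j))‖ ^ 2) := by
  simp_rw [← tsum_ofReal_norm_inner_sq (CFC.sqrt A _), ← tsum_ofReal_norm_inner_sq (CFC.sqrt T _)]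
  rw [ENNReal.tsum_comm]
  refine tsum_congr fun i => tsum_congr fun j => ?_
  rw [← inner_sqrt_left, ← inner_sqrt_left, norm_inner_symm]

theorem re_inner_apply_eq_norm_sqrt_sq {A : H →L[ℂ] H} (hA : 0 ≤ A) (x : H) :
    (⟪x, A x⟫_ℂ).re = ‖CFC.sqrt A x‖ ^ 2 := by
  rw [inner_apply_of_nonneg hA]
  exact inner_self_eq_norm_sq (𝕜 := ℂ) _

theorem re_inner_apply_mono {A B : H →L[ℂ] H} (h : A ≤ B) (x : H) :
    (⟪x, A x⟫_ℂ).re ≤ (⟪x, B x⟫_ℂ).re := by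
  have := ((ContinuousLinearMap.nonneg_iff_isPositive _).1
    (sub_nonneg.2 h)).re_inner_nonneg_right x
  simp only [sub_apply, inner_sub_right, map_sub] at this
  exact sub_nonneg.1 this

/-- `Tr (T A) = ∑ⱼ ⟪A^{1/2} eⱼ, T A^{1/2} eⱼ⟫` for positive trace-class `T` and positive `A`. -/
theorem ofReal_re_trace_mul_eq_tsum_inner_sqrt {T A : H →L[ℂ] H} (hT : 0 ≤ T)
    (hT' : IsTraceClass T) (hA : 0 ≤ A) :
    ENNReal.ofReal (trace (T * A)).re =
      ∑' j, ENNReal.ofReal (⟪CFC.sqrt A (basis H j), T (CFC.sqrt A (basis H j))⟫_ℂ).re := by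
  rw [ofReal_re_trace_mul hT hT' hA]
  simp_rw [re_inner_apply_eq_norm_sqrt_sq hA, re_inner_apply_eq_norm_sqrt_sq hT]
  exact tsum_norm_sq_sqrt_comm A T

/-- With the vectors `A^{1/2} eⱼ`, common to all three traces, the operator inequality applies term
by term. -/
theorem ofReal_re_trace_mul_le_add {T S X A : H →L[ℂ] H} (hT : 0 ≤ T) (hT' : IsTraceClass T)
    (hS : 0 ≤ S) (hS' : IsTraceClass S) (hX : 0 ≤ X) (hX' : IsTraceClass X) (hA : 0 ≤ A)
    (h : T ≤ S + X) :
    ENNReal.ofReal (trace (T * A)).re ≤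
      ENNReal.ofReal (trace (S * A)).re + ENNReal.ofReal (trace (X * A)).re := by
  rw [ofReal_re_trace_mul_eq_tsum_inner_sqrt hT hT' hA,
    ofReal_re_trace_mul_eq_tsum_inner_sqrt hS hS' hA,
    ofReal_re_trace_mul_eq_tsum_inner_sqrt hX hX' hA, ← ENNReal.tsum_add]
  refine ENNReal.tsum_le_tsum fun j => ?_
  refine (ENNReal.ofReal_le_ofReal (re_inner_apply_mono h _)).trans ?_
  rw [add_apply, inner_add_right, Complex.add_re]
  exact ENNReal.ofReal_add_le

theorem ofReal_re_trace_eq_traceNorm {T : H →L[ℂ] H} (hT : 0 ≤ T) (hT' : IsTraceClass T) :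
    ENNReal.ofReal (trace T).re = traceNorm T := by
  have h := ofReal_re_trace_mul hT hT' (A := 1) (zero_le_one' (H →L[ℂ] H))
  rw [mul_one] at h
  rw [h, traceNorm]
  refine tsum_congr fun j => ?_
  rw [CFC.abs_of_nonneg T hT, inner_apply_of_nonneg hT]
  rfl

theorem DensityOperator.ofReal_re_trace_mul_combination (ρ : DensityOperator H) {a b : ℝ}
    (ha : 0 ≤ a) (hb : 0 ≤ b) {A B C : H →L[ℂ] H} (hA : 0 ≤ A) (hB : 0 ≤ B) (hC : 0 ≤ C)
    (h : C = (a : ℂ) • A + (b : ℂ) • B) :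
    ENNReal.ofReal (trace (ρ.toCLM * C)).re =
      ENNReal.ofReal a * ENNReal.ofReal (trace (ρ.toCLM * A)).re +
        ENNReal.ofReal b * ENNReal.ofReal (trace (ρ.toCLM * B)).re := by
  rw [ofReal_re_trace_mul ρ.nonneg ρ.isTraceClass hA, ofReal_re_trace_mul ρ.nonneg ρ.isTraceClass hB,
    ofReal_re_trace_mul ρ.nonneg ρ.isTraceClass hC, ← ENNReal.tsum_mul_left,
    ← ENNReal.tsum_mul_left, ← ENNReal.tsum_add]
  refine tsum_congr fun j => ?_
  have hA' := re_inner_apply_mono hA (CFC.sqrt ρ.toCLM (basis H j))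
  have hB' := re_inner_apply_mono hB (CFC.sqrt ρ.toCLM (basis H j))
  simp only [zero_apply, inner_zero_right, Complex.zero_re] at hA' hB'
  rw [← ENNReal.ofReal_mul ha, ← ENNReal.ofReal_mul hb, ← ENNReal.ofReal_add (by positivity)
    (by positivity), h]
  simp

end Trace

section Effect

variable {U : Type*} [MeasurableSpace U] {H : Type*} [NormedAddCommGroup H] [InnerProductSpace ℂ H]

theorem POVM.effect_nonneg (M : POVM U H) {B : Set U} (hB : MeasurableSet B) : 0 ≤ M.effect B :=
  M.nonneg B hB

theorem POVM.effect_univ (M : POVM U H) : M.effect Set.univ = 1 := by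
  simp [POVM.effect, M.univ_eq_one]

end Effect

/-! ### Outcome laws: domination and mixtures -/

section Born

variable {U : Type*} [MeasurableSpace U]
  {H : Type*} [NormedAddCommGroup H] [InnerProductSpace ℂ H] [CompleteSpace H]

instance isProbabilityMeasure_born (ρ : DensityOperator H) (M : POVM U H) :
    IsProbabilityMeasure (born ρ M) :=
  ⟨by rw [born_apply _ _ MeasurableSet.univ, M.effect_univ, mul_one, ρ.trace_eq_one]; simp⟩

/-- The measure `B ↦ Tr (T M(B))` for a positive trace-class operator `T`. -/
noncomputable def traceMeasure {T : H →L[ℂ] H} (hT : 0 ≤ T) (hT' : IsTraceClass T)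
    (M : POVM U H) : Measure U :=
  Measure.ofMeasurable (fun B _ => ENNReal.ofReal (trace (T * M.effect B)).re)
    (by simp [POVM.effect_empty, trace])
    (by
      intro B hB hd
      rw [ofReal_re_trace_mul hT hT' (M.effect_nonneg (MeasurableSet.iUnion hB)),
        tsum_congr fun k => ofReal_re_trace_mul hT hT' (M.effect_nonneg (hB k)), ENNReal.tsum_comm]
      refine tsum_congr fun j => ?_
      have h := M.hasSum_re_inner hB hd (CFC.sqrt T (basis H j))
      have hpos : ∀ k, 0 ≤ (⟪CFC.sqrt T (basis H j), M.effect (B k)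
          (CFC.sqrt T (basis H j))⟫_ℂ).re := fun k => by
        simpa using re_inner_apply_mono (M.effect_nonneg (hB k)) (CFC.sqrt T (basis H j))
      rw [← ENNReal.ofReal_tsum_of_nonneg hpos h.summable]
      exact congrArg ENNReal.ofReal h.tsum_eq.symm)

theorem traceMeasure_apply {T : H →L[ℂ] H} (hT : 0 ≤ T) (hT' : IsTraceClass T) (M : POVM U H)
    {B : Set U} (hB : MeasurableSet B) :
    traceMeasure hT hT' M B = ENNReal.ofReal (trace (T * M.effect B)).re :=
  Measure.ofMeasurable_apply B hB

theorem traceMeasure_univ {T : H →L[ℂ] H} (hT : 0 ≤ T) (hT' : IsTraceClass T) (M : POVM U H) :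
    traceMeasure hT hT' M Set.univ = traceNorm T := by
  rw [traceMeasure_apply _ _ _ MeasurableSet.univ, M.effect_univ, mul_one,
    ofReal_re_trace_eq_traceNorm hT hT']

theorem born_le_add_traceMeasure {ρ σ : DensityOperator H} {X : H →L[ℂ] H} (hX : 0 ≤ X)
    (hX' : IsTraceClass X) (h : ρ.toCLM - σ.toCLM ≤ X) (M : POVM U H) :
    born ρ M ≤ born σ M + traceMeasure hX hX' M := by
  refine Measure.le_iff.2 fun B hB => ?_
  rw [Measure.add_apply, born_apply _ _ hB, born_apply _ _ hB, traceMeasure_apply _ _ _ hB]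
  exact ofReal_re_trace_mul_le_add ρ.nonneg ρ.isTraceClass σ.nonneg σ.isTraceClass hX hX'
    (M.effect_nonneg hB) (by rwa [add_comm, ← sub_le_iff_le_add])

theorem integral_born_le_add {ρ σ : DensityOperator H} {X : H →L[ℂ] H} (hX : 0 ≤ X)
    (hX' : IsTraceClass X) (h : ρ.toCLM - σ.toCLM ≤ X) (M : POVM U H) {f : U → ℝ}
    (hf : StronglyMeasurable f) {C : ℝ} (hC : ∀ u, |f u| ≤ C) :
    ∫ u, f u ∂(born ρ M) ≤ ∫ u, f u ∂(born σ M) + 2 * C * (traceNorm X).toReal := by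
  set τ := traceMeasure hX hX' M with hτ
  have hτu : τ Set.univ = traceNorm X := traceMeasure_univ hX hX' M
  have : IsFiniteMeasure τ := ⟨by rw [hτu]; exact hX'⟩
  have hint : ∀ (μ : Measure U) [IsFiniteMeasure μ], Integrable f μ := fun μ _ =>
    Integrable.of_bound hf.aestronglyMeasurable C (ae_of_all _ hC)
  -- Monotonicity in the measure needs a nonnegative integrand. The shifted one takes values in `[0,
  -- 2C]`, whence the factor `2 * C`.
  have key : ∫ u, (f u + C) ∂(born ρ M) ≤ ∫ u, (f u + C) ∂(born σ M + τ) :=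
    integral_mono_measure (born_le_add_traceMeasure hX hX' h M)
      (ae_of_all _ fun u => by have := (abs_le.1 (hC u)).1; simp only [Pi.zero_apply]; linarith)
      ((hint _).add (integrable_const C))
  have hintC : ∀ (μ : Measure U) [IsFiniteMeasure μ], Integrable (fun u => f u + C) μ := fun μ _ =>
    (hint μ).add (integrable_const C)
  rw [integral_add_measure (hintC _) (hintC _), integral_add (hint _) (integrable_const C), integral_add (hint _) (integrable_const C)] at key
  have hlast : ∫ u, (f u + C) ∂τ ≤ 2 * C * (traceNorm X).toReal := by
    have : ∫ u, (f u + C) ∂τ ≤ ∫ _, 2 * C ∂τ :=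
      integral_mono ((hint _).add (integrable_const C)) (integrable_const _)
        fun u => by have := (abs_le.1 (hC u)).2; simp only; linarith
    rw [integral_const, smul_eq_mul, measureReal_def, hτu] at this
    linarith
  simp only [integral_const, probReal_univ, one_smul] at key
  linarith

open scoped ComplexOrder in
/-- Randomization between two measurements. -/
noncomputable def POVM.mix (M N : POVM U H) {a b : ℝ} (ha : 0 ≤ a) (hb : 0 ≤ b)
    (hab : a + b = 1) : POVM U H where
  toVectorMeasure := (a : ℂ) • M.toVectorMeasure + (b : ℂ) • N.toVectorMeasure
  nonneg B hB := by
    have hA := M.nonneg B hB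
    have hB := N.nonneg B hB
    have ha' : (0 : ℂ) ≤ a := by exact_mod_cast ha
    have hb' : (0 : ℂ) ≤ b := by exact_mod_cast hb
    simp only [add_apply, smul_apply, ContinuousLinearMapWOT.toCLM_add,
      ContinuousLinearMapWOT.toCLM_smul]
    exact add_nonneg (smul_nonneg ha' hA) (smul_nonneg hb' hB)
  univ_eq_one := by
    have : (a : ℂ) + b = 1 := by exact_mod_cast hab
    rw [add_apply, smul_apply, smul_apply, M.univ_eq_one, N.univ_eq_one, ← add_smul, this, one_smul]

theorem born_mix (ρ : DensityOperator H) (M N : POVM U H) {a b : ℝ} (ha : 0 ≤ a) (hb : 0 ≤ b)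
    (hab : a + b = 1) :
    born ρ (M.mix N ha hb hab) = ENNReal.ofReal a • born ρ M + ENNReal.ofReal b • born ρ N := by
  ext B hB
  rw [Measure.add_apply, Measure.smul_apply, Measure.smul_apply, born_apply _ _ hB,
    born_apply _ _ hB, born_apply _ _ hB]
  exact ρ.ofReal_re_trace_mul_combination ha hb (M.effect_nonneg hB) (N.effect_nonneg hB)
    (POVM.effect_nonneg _ hB) (by simp [POVM.effect, POVM.mix])

end Born

/-! ### Separation in the space of continuous functions -/

section Separation

variable {X : Type*} [TopologicalSpace X] [CompactSpace X] [T2Space X] [MeasurableSpace X]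
  [BorelSpace X]

open CompactlySupported in
/-- The **Riesz-Markov-Kakutani representation theorem** on a compact space. -/
theorem exists_isFiniteMeasure_integral_eq (l : C(X, ℝ) →ₗ[ℝ] ℝ) (hl : ∀ f, 0 ≤ f → 0 ≤ l f) :
    ∃ μ : Measure X, IsFiniteMeasure μ ∧ ∀ f : C(X, ℝ), ∫ x, f x ∂μ = l f := by
  let toC : C_c(X, ℝ) →ₗ[ℝ] C(X, ℝ) :=
    { toFun := fun f => f.toContinuousMap
      map_add' := fun _ _ => rfl
      map_smul' := fun _ _ => rfl }
  let Λ : C_c(X, ℝ) →ₚ[ℝ] ℝ := PositiveLinearMap.mk₀ (l ∘ₗ toC) fun f hf => hl _ fun x => hf x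
  exact ⟨RealRMK.rieszMeasure Λ, inferInstance, fun f =>
    RealRMK.integral_rieszMeasure Λ (CompactlySupportedContinuousMap.continuousMapEquiv f)⟩

/-- If no member of a convex set of continuous functions is below `c` everywhere, then some
probability measure integrates all members to at least `c`. -/
theorem exists_probabilityMeasure_forall_le_integral {K : Set C(X, ℝ)} (hK : Convex ℝ K)
    (hne : K.Nonempty) {c : ℝ} (hc : ∀ f ∈ K, ∃ x, c ≤ f x) :
    ∃ π : ProbabilityMeasure X, ∀ f ∈ K, c ≤ ∫ x, f x ∂(π : Measure X) := by
  set S : Set C(X, ℝ) := {f | Set.MapsTo f Set.univ (Set.Iio c)} with hS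
  have hSo : IsOpen S := ContinuousMap.isOpen_setOfPred_mapsTo isCompact_univ isOpen_Iio
  have hSc : Convex ℝ S := by
    intro f hf g hg a b ha hb hab x hx
    exact convex_Iio (𝕜 := ℝ) c (hf hx) (hg hx) ha hb hab
  have hdisj : Disjoint S K := by
    refine Set.disjoint_left.2 fun f hf hfK => ?_
    obtain ⟨x, hx⟩ := hc f hfK
    exact (hf (Set.mem_univ x)).not_ge hx
  obtain ⟨l, u, hlS, hlK⟩ := geometric_hahn_banach_open hSc hSo hK hdisj
  have hpos : ∀ f : C(X, ℝ), 0 ≤ f → 0 ≤ l f := by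
    intro f hf
    by_contra! hneg
    -- Subtracting multiples of `f ≥ 0` never leaves `S`, so `l` is bounded above along this ray. If
    -- `l f < 0`, the value of `t` used below makes the left side equal to `u`.
    have hmem : ∀ t : ℝ, 0 ≤ t → (c - 1) * l 1 - t * l f < u := by
      intro t ht
      have : (c - 1) • (1 : C(X, ℝ)) - t • f ∈ S := by
        intro x _
        have : 0 ≤ t * f x := mul_nonneg ht (hf x)
        simp only [Set.mem_Iio, ContinuousMap.sub_apply, ContinuousMap.smul_apply,
          ContinuousMap.one_apply, smul_eq_mul]
        linarith
      simpa using hlS _ this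
    have h0 := hmem 0 le_rfl
    have h1 := hmem ((u - (c - 1) * l 1) / -l f)
      (div_nonneg (by linarith) (by linarith))
    rw [div_neg, neg_mul, div_mul_cancel₀ _ hneg.ne] at h1
    linarith
  obtain ⟨μ, hμ, hint⟩ := exists_isFiniteMeasure_integral_eq (l : C(X, ℝ) →ₗ[ℝ] ℝ) hpos
  have hmass : l 1 = μ.real Set.univ := by
    have := hint 1
    simpa using this.symm
  -- A zero functional would give `0 < u` on `S` and `u ≤ 0` on `K`.
  have hμ0 : μ ≠ 0 := by
    rintro rfl
    have hzero : ∀ f, l f = 0 := fun f => by simpa using (hint f).symm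
    obtain ⟨f, hf⟩ := hne
    have h1 := hlK f hf
    have h2 := hlS ((c - 1) • (1 : C(X, ℝ))) fun x _ => by simp
    rw [hzero] at h1 h2
    linarith
  have hmass_pos : 0 < μ.real Set.univ := by
    have : NeZero μ := ⟨hμ0⟩
    exact measureReal_univ_pos
  -- Constants slightly below `c` lie in `S`; let them tend to `c`.
  have hcu : c * l 1 ≤ u := by
    refine le_of_forall_pos_lt_add fun ε hε => ?_
    have hε' : 0 < ε / μ.real Set.univ := by positivity
    have h2 := hlS ((c - ε / μ.real Set.univ) • (1 : C(X, ℝ))) fun x _ => by simpa using hε'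
    rw [map_smul, smul_eq_mul, hmass, sub_mul, div_mul_cancel₀ _ hmass_pos.ne'] at h2
    rw [hmass]
    linarith
  have : NeZero μ := ⟨hμ0⟩
  refine ⟨⟨(μ Set.univ)⁻¹ • μ, inferInstance⟩, fun f hf => ?_⟩
  have h1 := hcu.trans (hlK f hf)
  have h2 : ∫ x, f x ∂μ = l f := hint f
  rw [ProbabilityMeasure.coe_mk, integral_smul_measure, ENNReal.toReal_inv, ← measureReal_def,
    h2, smul_eq_mul, ← div_eq_inv_mul, le_div_iff₀ hmass_pos, ← hmass]
  exact h1

end Separation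

/-! ### Integrability of the loss and affinity of the risk -/

section Loss

variable {Θ : Type*} [MetricSpace Θ] {U : Type*} [MetricSpace U] [MeasurableSpace U] [BorelSpace U]

theorem stronglyMeasurable_loss (w : BoundedContinuousFunction (Θ × U) ℝ) (θ : Θ) :
    StronglyMeasurable fun u => w (θ, u) :=
  (w.continuous.comp (by fun_prop : Continuous fun u : U => (θ, u))).stronglyMeasurable

theorem integrable_loss (w : BoundedContinuousFunction (Θ × U) ℝ) (θ : Θ) (μ : Measure U)
    [IsFiniteMeasure μ] : Integrable (fun u => w (θ, u)) μ :=
  Integrable.of_bound (stronglyMeasurable_loss w θ).aestronglyMeasurable ‖w‖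
    (ae_of_all _ fun _ => w.norm_coe_le_norm _)

theorem risk_mix {H : Type*} [NormedAddCommGroup H] [InnerProductSpace ℂ H] [CompleteSpace H]
    (ρ : Θ → DensityOperator H) (w : BoundedContinuousFunction (Θ × U) ℝ)
    (M N : POVM U H) {a b : ℝ} (ha : 0 ≤ a) (hb : 0 ≤ b) (hab : a + b = 1) (θ : Θ) :
    risk ρ w (M.mix N ha hb hab) θ = a * risk ρ w M θ + b * risk ρ w N θ := by
  unfold risk
  rw [born_mix, integral_add_measure, integral_smul_measure, integral_smul_measure,
    ENNReal.toReal_ofReal ha, ENNReal.toReal_ofReal hb, smul_eq_mul, smul_eq_mul]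
  · exact (integrable_loss w θ _).smul_measure ENNReal.ofReal_ne_top
  · exact (integrable_loss w θ _).smul_measure ENNReal.ofReal_ne_top

end Loss

/-! ### Continuity and convexity of the risk functions -/

section Risk

variable {Θ : Type*} [MetricSpace Θ] [CompactSpace Θ]
  {U : Type*} [MetricSpace U] [CompactSpace U] [MeasurableSpace U] [BorelSpace U]
  {H : Type*} [NormedAddCommGroup H] [InnerProductSpace ℂ H] [CompleteSpace H]

theorem continuous_risk {ρ : Θ → DensityOperator H} (hρ : IsRegularFamily fun θ => (ρ θ).toCLM)
    (w : BoundedContinuousFunction (Θ × U) ℝ) (M : POVM U H) : Continuous (risk ρ w M) := by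
  rw [Metric.continuous_iff]
  intro θ₀ ε hε
  -- Half of `ε` pays for the change of state, half for the change of loss; the `+ 1` covers `‖w‖ =
  -- 0`.
  set η : ℝ := ε / 2 / (2 * ‖w‖ + 1) with hη
  have hη0 : 0 < η := by positivity
  obtain ⟨δ, hδ, hδ0⟩ := (((hρ Set.univ isCompact_univ).eventually_lt_const
    (ENNReal.ofReal_pos.2 hη0)).and self_mem_nhdsWithin).exists
  obtain ⟨_, ⟨X, hX', hXb, rfl⟩, hXη⟩ := sInf_lt_iff.1 hδ
  -- Comparing `θ₀` with itself gives `0 ≤ X`.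
  have hX : 0 ≤ X := by
    simpa using (hXb θ₀ trivial θ₀ trivial (by simpa using hδ0)).2
  have hXr : (traceNorm X).toReal < η :=
    (ENNReal.lt_ofReal_iff_toReal_lt hX'.ne).1 hXη
  obtain ⟨δ', hδ', hw⟩ := Metric.uniformContinuous_iff.1
    (CompactSpace.uniformContinuous_of_continuous w.continuous) (ε / 2) (by positivity)
  have key : ∀ θ θ' : Θ, dist θ θ' < min δ δ' → risk ρ w M θ < risk ρ w M θ' + ε := by
    intro θ θ' hd
    have h1 := integral_born_le_add hX hX'
      (hXb θ trivial θ' trivial (hd.trans_le (min_le_left _ _))).2 M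
      (stronglyMeasurable_loss w θ) fun u => w.norm_coe_le_norm (θ, u)
    have h2 : ∫ u, w (θ, u) ∂(born (ρ θ') M) ≤ ∫ u, (w (θ', u) + ε / 2) ∂(born (ρ θ') M) := by
      refine integral_mono (integrable_loss w θ _)
        ((integrable_loss w θ' _).add (integrable_const _)) fun u => ?_
      have h3 : dist (θ, u) (θ', u) < δ' := by
        rw [Prod.dist_eq, dist_self]
        exact max_lt (hd.trans_le (min_le_right _ _)) hδ'
      have := (abs_lt.1 (hw h3)).2
      simp only
      linarith
    rw [integral_add (integrable_loss w θ' _) (integrable_const _)] at h2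
    simp only [integral_const, probReal_univ, one_smul] at h2
    have h4 : 2 * ‖w‖ * (traceNorm X).toReal < ε / 2 := by
      calc 2 * ‖w‖ * (traceNorm X).toReal ≤ 2 * ‖w‖ * η := by gcongr
        _ < (2 * ‖w‖ + 1) * η := by linarith
        _ = ε / 2 := by rw [hη]; field_simp
    unfold risk
    linarith
  refine ⟨min δ δ', lt_min hδ0 hδ', fun θ hd => ?_⟩
  rw [Real.dist_eq, abs_lt]
  have h1 := key θ θ₀ hd
  have h2 := key θ₀ θ (by rwa [dist_comm])
  constructor <;> linarith

theorem convex_range_risk {ρ : Θ → DensityOperator H}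
    (hρ : IsRegularFamily fun θ => (ρ θ).toCLM) (w : BoundedContinuousFunction (Θ × U) ℝ) :
    Convex ℝ (Set.range fun M : POVM U H => (⟨risk ρ w M, continuous_risk hρ w M⟩ : C(Θ, ℝ))) := by
  rintro _ ⟨M, rfl⟩ _ ⟨N, rfl⟩ a b ha hb hab
  refine ⟨M.mix N ha hb hab, ContinuousMap.ext fun θ => ?_⟩
  exact risk_mix ρ w M N ha hb hab θ

theorem integrable_risk [MeasurableSpace Θ] [BorelSpace Θ] {ρ : Θ → DensityOperator H}
    (hρ : IsRegularFamily fun θ => (ρ θ).toCLM) (w : BoundedContinuousFunction (Θ × U) ℝ)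
    (M : POVM U H) (π : Measure Θ) [IsFiniteMeasure π] : Integrable (risk ρ w M) π :=
  (continuous_risk hρ w M).integrable_of_hasCompactSupport (HasCompactSupport.of_compactSpace _)

end Risk
end QuantumDecision

/-! ### The minimax equality -/

open QuantumDecision in
/-- Quantum minimax theorem for bounded continuous loss functions. -/
theorem theorem2
    {Θ : Type*} [MetricSpace Θ] [CompactSpace Θ] [Nonempty Θ] [MeasurableSpace Θ] [BorelSpace Θ]
    {U : Type*} [MetricSpace U] [CompactSpace U] [MeasurableSpace U] [BorelSpace U]
    {H : Type*} [NormedAddCommGroup H] [InnerProductSpace ℂ H] [CompleteSpace H]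
    (ρ : Θ → DensityOperator H) (hρ : IsRegularFamily fun θ => (ρ θ).toCLM)
    (w : BoundedContinuousFunction (Θ × U) ℝ) :
    (∀ (M : POVM U H) (θ : Θ), Integrable (fun u => w (θ, u)) (born (ρ θ) M)) ∧
    (∀ (M : POVM U H) (π : ProbabilityMeasure Θ), Integrable (risk ρ w M) (π : Measure Θ)) ∧
    (⨅ M : POVM U H, ⨆ θ : Θ, ((risk ρ w M θ : ℝ) : EReal)) =
      ⨆ π : ProbabilityMeasure Θ, ⨅ M : POVM U H,
        ((∫ θ, risk ρ w M θ ∂(π : Measure Θ) : ℝ) : EReal) := by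
  refine ⟨fun M θ => integrable_loss w θ _, fun M π => integrable_risk hρ w M _,
    le_antisymm ?_ ?_⟩
  · rcases isEmpty_or_nonempty (POVM U H) with hempty | hne
    -- Without POVMs (`U` may be empty) both infima are `⊤`; a prior must exist for the supremum not
    -- to be `⊥`.
    · have : Nonempty (ProbabilityMeasure Θ) :=
        ⟨⟨Measure.dirac (Classical.arbitrary Θ), inferInstance⟩⟩
      exact le_iSup_of_le (Classical.arbitrary _) (le_iInf fun M => isEmptyElim M)
    -- Testing against real `c` strictly below the minimax value gives each risk function a point
    -- with risk above `c`, without attainment.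
    refine EReal.ge_of_forall_gt_iff_ge.1 fun c hc => ?_
    obtain ⟨π, hπ⟩ := exists_probabilityMeasure_forall_le_integral (convex_range_risk hρ w)
      (Set.range_nonempty _) (c := c) (by
        rintro _ ⟨M, rfl⟩
        obtain ⟨θ, hθ⟩ := lt_iSup_iff.1 (hc.trans_le (iInf_le _ M))
        exact ⟨θ, (EReal.coe_lt_coe_iff.1 hθ).le⟩)
    refine le_iSup_of_le π (le_iInf fun M => EReal.coe_le_coe_iff.2 ?_)
    exact hπ _ ⟨M, rfl⟩
  · refine iSup_le fun π => le_iInf fun M => (iInf_le _ M).trans ?_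
    obtain ⟨θ, hθ⟩ := exists_integral_le (integrable_risk hρ w M (π : Measure Θ))
    exact le_iSup_of_le θ (EReal.coe_le_coe_iff.2 hθ)
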